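/- A pebble configuration on a finite directed acyclic graph $G$ is a set $P$ of vertices. A \emph{standard} pebbling is a sequence of configurations, starting with $\emptyset$, in which each step either adds a vertex $v\notin P$ all of whose predecessors are in $P$, or removes any vertex $v\in P$. A \emph{reversible} pebbling is defined in the same way, except that $v$ may be removed only if all predecessors of $v$ are in $P$. The space of a pebbling is the largest size of its configurations. If $G$ has a unique sink $z$, its standard pebbling price $\mathrm{Peb}(G)$ and its reversible pebbling price $\mathrm{Rev}(G)$ are the minimum space of a standard, respectively reversible, pebbling that ends in the configuration $\{z\}$. For $w\ge 1$ and $\ell\ge w-1$, the \emph{road} $R_{w,\ell}$ of width $w$ and length $\ell$ has as vertices the pairs $(i,j)$ of integers with $0\le i\le\ell$, $0\le j<w$ and $i+j\le\ell$ ($i$ is the layer); the predecessors of $(i+1,j)$ are $(i,j)$ and $(i,(j+1)\bmod w)$. (So it is a chain of layers of width $w$, with wrap-around, topped by a pyramid of height $w-1$.) (a) For all integers $w\ge 1$ and $\ell\ge w-1$ with $\ell \geq 1$, $$\mathrm{Rev}(R_{w,\ell})\;\ge\;\tfrac12\,w\log_2(\ell/w).$$ (b) There are absolute constants $a,b,C,c>0$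 such that the following holds. Let $\varepsilon>0$ and let $s:\mathbb N\to\mathbb R$ satisfy $s(n)=O(n^{1/2-\varepsilon})$, and $s(n)\ge 1$ for all large $n$. Then there are roads $G_n$ ($n\ge 1$), which are DAGs with a single sink and fan-in at most $2$, such that the number of vertices of $G_n$ is between $a\,n$ and $b\,n$ for all $n\ge1$, and, for all sufficiently large $n$, $$\mathrm{Peb}(G_n)\le C\,s(n)\qquad\text{and}\qquad \mathrm{Rev}(G_n)\ge c\,\varepsilon\, s(n)\log_2 n .$$ -/

import Mathlib

open Filter Asymptotics

namespace Pebbling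

section General

variable {V : Type*}

/-- A directed graph is acyclic if no vertex has a directed path of positive length to itself. -/
def IsAcyclic (G : Digraph V) : Prop :=
  ∀ v, ¬ Relation.TransGen G.Adj v v

/-- A sink is a vertex without outgoing edges. -/
def IsSink (G : Digraph V) (v : V) : Prop :=
  ∀ u, ¬ G.Adj v u

/-- Every vertex has at most `k` predecessors. -/
def FanInAtMost (G : Digraph V) (k : ℕ) : Prop :=
  ∀ v, {u | G.Adj u v}.encard ≤ k

/-- `P 0, …, P τ` is a pebbling, with moves from `move`, that starts with no pebbles and ends in
the configuration `C`. -/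
def IsPebbling (move : Finset V → Finset V → Prop) (C : Finset V) (τ : ℕ)
    (P : ℕ → Finset V) : Prop :=
  P 0 = ∅ ∧ P τ = C ∧ ∀ t < τ, move (P t) (P (t + 1))

/-- The space of the pebbling `P 0, …, P τ`: the largest number of pebbles in use. -/
def space (τ : ℕ) (P : ℕ → Finset V) : ℕ :=
  (Finset.range (τ + 1)).sup fun t => (P t).card

/-- The minimum space of a pebbling, with moves from `move`, that ends in `C`. -/
noncomputable def configPrice (move : Finset V → Finset V → Prop) (C : Finset V) : ℕ :=
  sInf {m | ∃ τ P, IsPebbling move C τ P ∧ space τ P = m}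

theorem exists_isPebbling_of_reflTransGen {move : Finset V → Finset V → Prop} {C : Finset V}
    (h : Relation.ReflTransGen move ∅ C) : ∃ τ P, IsPebbling move C τ P := by
  induction h with
  | refl => exact ⟨0, fun _ => ∅, rfl, rfl, fun t ht => absurd ht (Nat.not_lt_zero t)⟩
  | @tail B C _ hBC ih =>
    obtain ⟨τ, P, h0, h1, h2⟩ := ih
    refine ⟨τ + 1, fun t => if t ≤ τ then P t else C, by simpa using h0, by simp, ?_⟩
    intro t ht
    rcases Nat.lt_or_ge t τ with h | h
    · simpa [h.le, Nat.succ_le_of_lt h] using h2 t h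
    · obtain rfl : t = τ := by omega
      simpa [h1] using hBC

variable [DecidableEq V]

/-- `P'` is obtained from `P` by placing a pebble on an empty vertex all of whose predecessors
carry pebbles. -/
def Placement (G : Digraph V) (P P' : Finset V) : Prop :=
  ∃ v, v ∉ P ∧ (∀ u, G.Adj u v → u ∈ P) ∧ P' = insert v P

/-- `P'` is obtained from `P` by removing a pebble. -/
def Removal (P P' : Finset V) : Prop :=
  ∃ v, v ∈ P ∧ P' = P.erase v

/-- `P'` is obtained from `P` by removing a pebble from a vertex all of whose predecessors
carry pebbles. -/
def ReversibleRemoval (G : Digraph V) (P P' : Finset V) : Prop :=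
  ∃ v, v ∈ P ∧ (∀ u, G.Adj u v → u ∈ P) ∧ P' = P.erase v

/-- One move of the standard pebble game. -/
def StandardMove (G : Digraph V) (P P' : Finset V) : Prop :=
  Placement G P P' ∨ Removal P P'

/-- One move of the reversible pebble game. -/
def ReversibleMove (G : Digraph V) (P P' : Finset V) : Prop :=
  Placement G P P' ∨ ReversibleRemoval G P P'

section Sinks

variable [Fintype V]

open Classical in
/-- The set of sinks; it is `{z}` if `z` is the only sink. -/
noncomputable def sinks (G : Digraph V) : Finset V :=
  Finset.univ.filter (IsSink G)

/-- The (standard) pebbling price of a single-sink DAG: the minimum space of a standard pebbling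
that ends with exactly one pebble, on the sink. -/
noncomputable def standardPrice (G : Digraph V) : ℕ :=
  configPrice (StandardMove G) (sinks G)

/-- The reversible pebbling price of a single-sink DAG: the minimum space of a reversible pebbling
that ends with exactly one pebble, on the sink. -/
noncomputable def reversiblePrice (G : Digraph V) : ℕ :=
  configPrice (ReversibleMove G) (sinks G)

end Sinks

/-! On a finite DAG every configuration is reached by a reversible pebbling, hence the minimum in
`configPrice` is over a nonempty set, for both games. -/

theorem ReversibleMove.symm {G : Digraph V} (hG : IsAcyclic G) {P Q : Finset V}
    (h : ReversibleMove G P Q) : ReversibleMove G Q P := by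
  have hl : ∀ v, ¬ G.Adj v v := fun v hv => hG v (.single hv)
  rcases h with ⟨v, hv, hp, rfl⟩ | ⟨v, hv, hp, rfl⟩
  · exact Or.inr ⟨v, Finset.mem_insert_self _ _, fun u hu => Finset.mem_insert_of_mem (hp u hu),
      (Finset.erase_insert hv).symm⟩
  · refine Or.inl ⟨v, Finset.notMem_erase _ _, fun u hu => ?_, (Finset.insert_erase hv).symm⟩
    exact Finset.mem_erase.2 ⟨fun h => hl v (h ▸ hu), hp u hu⟩

theorem reversible_reach_aux [Finite V] {G : Digraph V} (hG : IsAcyclic G) (C : Finset V) (n : ℕ) :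
    ∀ D X : Finset V, D.card = n → (∀ v ∈ D, ∀ u, G.Adj u v → u ∈ D) → Disjoint D X →
      Relation.ReflTransGen (ReversibleMove G) (D ∪ X) ((D ∩ C) ∪ X) := by
  have hl : ∀ v, ¬ G.Adj v v := fun v hv => hG v (.single hv)
  induction n with
  | zero =>
    intro D X hD _ _
    rw [Finset.card_eq_zero] at hD
    subst hD
    simpa using Relation.ReflTransGen.refl
  | succ n ih =>
    intro D X hD hcl hdisj
    have hne : D.Nonempty := Finset.card_pos.1 (by omega)
    let r : V → V → Prop := fun a b => Relation.TransGen G.Adj b a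
    have : IsTrans V r := ⟨fun a b c h1 h2 => Relation.TransGen.trans h2 h1⟩
    have : Std.Irrefl r := ⟨fun a h => hG a h⟩
    have wf : WellFounded r := Finite.wellFounded_of_trans_of_irrefl r
    obtain ⟨m, hm, hmin⟩ := wf.has_min (D : Set V) hne
    have hm' : m ∈ D := hm
    have hmX : m ∉ X := Finset.disjoint_left.1 hdisj hm'
    have hcl' : ∀ v ∈ D.erase m, ∀ u, G.Adj u v → u ∈ D.erase m := by
      intro v hv u hu
      have hvD := Finset.mem_of_mem_erase hv
      refine Finset.mem_erase.2 ⟨?_, hcl v hvD u hu⟩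
      rintro rfl
      exact hmin v hvD (.single hu)
    have hcard : (D.erase m).card = n := by rw [Finset.card_erase_of_mem hm']; omega
    by_cases hC : m ∈ C
    · have h := ih (D.erase m) (insert m X) hcard hcl' (by
        rw [Finset.disjoint_insert_right]
        exact ⟨Finset.notMem_erase _ _, hdisj.mono_left (Finset.erase_subset _ _)⟩)
      have e1 : D.erase m ∪ insert m X = D ∪ X := by
        ext x; rcases eq_or_ne x m with rfl | hx <;> simp [*]
      have e2 : (D.erase m ∩ C) ∪ insert m X = (D ∩ C) ∪ X := by
        ext x; rcases eq_or_ne x m with rfl | hx <;> simp [*]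
      rwa [e1, e2] at h
    · have h := ih (D.erase m) X hcard hcl' (hdisj.mono_left (Finset.erase_subset _ _))
      have e2 : (D.erase m ∩ C) ∪ X = (D ∩ C) ∪ X := by
        ext x; rcases eq_or_ne x m with rfl | hx <;> simp [*]
      rw [e2] at h
      refine Relation.ReflTransGen.head (Or.inr ⟨m, Finset.mem_union_left _ hm', fun u hu => ?_, by
        rw [Finset.erase_union_distrib, Finset.erase_eq_of_notMem hmX]⟩) h
      exact Finset.mem_union_left _ (hcl m hm' u hu)

theorem exists_reversible_isPebbling [Fintype V] {G : Digraph V} (hG : IsAcyclic G)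
    (C : Finset V) : ∃ τ P, IsPebbling (ReversibleMove G) C τ P := by
  have key : ∀ C' : Finset V, Relation.ReflTransGen (ReversibleMove G) Finset.univ C' := fun C' => by
    simpa using reversible_reach_aux hG C' _ Finset.univ ∅ rfl (by simp) (by simp)
  have : Std.Symm (ReversibleMove G) := ⟨fun _ _ h => h.symm hG⟩
  exact exists_isPebbling_of_reflTransGen
    ((Relation.ReflTransGen.stdSymm.symm _ _ (key ∅)).trans (key C))

end General

/-! ### Roads -/

/-- The vertices of the road of width `w` and length `ℓ`: pairs of a layer `i ∈ {0, …, ℓ}` and a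
position in that layer. Layers `0, …, ℓ - w + 1` have `w` vertices each (the chain), and layer
`i` has `ℓ - i + 1` vertices for `ℓ - w + 1 ≤ i ≤ ℓ` (the pyramid of height `w - 1`). -/
abbrev RoadVertex (w ℓ : ℕ) : Type :=
  {p : Fin (ℓ + 1) × Fin w // (p.1 : ℕ) + (p.2 : ℕ) ≤ ℓ}

/-- The road of width `w` and length `ℓ`: the vertex at position `j` of a layer has incoming edges
from positions `j` and `j + 1` (modulo `w`) of the previous layer. In the pyramid, `j + 1 < w`, so
nothing wraps around there. -/
def road (w ℓ : ℕ) : Digraph (RoadVertex w ℓ) where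
  Adj u v := (v.1.1 : ℕ) = u.1.1 + 1 ∧
    ((u.1.2 : ℕ) = v.1.2 ∨ (u.1.2 : ℕ) = (v.1.2 + 1) % w)

end Pebbling

/-! View the road as part of an infinite cylinder. A section of layers is secure for `k` if a top
vertex that a pebble-free path joins to the bottom layer stays empty as long as the section holds at
most `k` pebbles. A pebbling starts empty, so a secure top section forces the reversible price above
`k`.

Two facts drive the argument. A reversible move needs all predecessors of its vertex pebbled, so it
can block an open path only at the first vertex (`Open.flip`). And fewer than `|U|` pebbles cannot
separate `U` from a path through `w` consecutive layers (`exists_open`), so blocked paths can be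
rerouted. This gives `secure_base`.

`Secure.double` stacks two secure sections and `w` spare layers, at a cost of only `h`, about `w /
2`, extra pebbles. If either half holds at least `h` pebbles, the other holds at most `k` and is
protected by its own security; a half with fewer than `h` pebbles leaves room to reroute. Iterating
adds about `w / 2` to the price each time the length roughly doubles, hence the logarithm.

For the separation, take width about `s n` and about `n` vertices: sweeping layer by layer costs `2
* w`, while `ℓ / w` is at least `n ^ ε`. -/

namespace Pebbling

/-! ### The infinite cylinder -/

namespace Cylinder

variable {w : ℕ}

/-- `Open a U P r x` says that some directed path of the infinite cylinder of circumference `w`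
leads from a vertex of layer `a` with position in `U` to `(r, x)`, and carries no pebble of `P`. -/
inductive Open (a : ℕ) (U : Set (ZMod w)) (P : Finset (ℕ × ZMod w)) : ℕ → ZMod w → Prop
  | base {x : ZMod w} : x ∈ U → (a, x) ∉ P → Open a U P a x
  | step {r : ℕ} {x y : ZMod w} :
      Open a U P r x → (x = y ∨ x = y + 1) → (r + 1, y) ∉ P → Open a U P (r + 1) y

/-- The configurations `P` and `Q` differ in at most one vertex, and all predecessors of that
vertex carry pebbles. -/
def Flip (P Q : Finset (ℕ × ZMod w)) : Prop :=
  ∃ v, (∀ u, u ≠ v → (u ∈ P ↔ u ∈ Q)) ∧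
    ∀ i x y, v = (i + 1, x) → (y = x ∨ y = x + 1) → (i, y) ∈ P ∧ (i, y) ∈ Q

/-- The number of pebbles in the layers `a, …, b`. -/
def load (P : Finset (ℕ × ZMod w)) (a b : ℕ) : ℕ :=
  (P.filter fun v => a ≤ v.1 ∧ v.1 ≤ b).card

/-- `P` and `Q` are connected by moves that keep at most `k` pebbles in the layers `a, …, b`. -/
def Conn (a b k : ℕ) : Finset (ℕ × ZMod w) → Finset (ℕ × ZMod w) → Prop :=
  Relation.ReflTransGen fun P Q => Flip P Q ∧ load P a b ≤ k ∧ load Q a b ≤ k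

/-- With at most `k` pebbles in a section of `N + 1` layers, no vertex of the top layer that is
open from the bottom layer is ever pebbled. -/
def Secure (w N k : ℕ) : Prop :=
  ∀ (a : ℕ) (P Q : Finset (ℕ × ZMod w)) (x : ZMod w), Conn a (a + N) k P Q →
    Open a Set.univ P (a + N) x → (a + N, x) ∉ Q

variable {P Q R : Finset (ℕ × ZMod w)} {a b c m r k N : ℕ} {U : Set (ZMod w)} {x y : ZMod w}

/-! ### Open paths under moves. -/

theorem Flip.symm (h : Flip P Q) : Flip Q P := by
  obtain ⟨v, h1, h2⟩ := h
  exact ⟨v, fun u hu => (h1 u hu).symm, fun i x y hv hy => (h2 i x y hv hy).symm⟩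

theorem Conn.symm (h : Conn a b k P Q) : Conn a b k Q P := by
  induction h with
  | refl => exact .refl
  | tail _ h ih => exact .head ⟨h.1.symm, h.2.2, h.2.1⟩ ih

theorem Conn.trans (h : Conn a b k P Q) (h' : Conn a b k Q R) : Conn a b k P R :=
  Relation.ReflTransGen.trans h h'

theorem Conn.tail (h : Conn a b k P Q) (h1 : Flip Q R) (h2 : load Q a b ≤ k)
    (h3 : load R a b ≤ k) : Conn a b k P R :=
  Relation.ReflTransGen.tail h ⟨h1, h2, h3⟩

theorem Open.notMem (h : Open a U P r x) : (r, x) ∉ P := by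
  cases h <;> assumption

theorem Open.le (h : Open a U P r x) : a ≤ r := by
  induction h with
  | base => exact le_rfl
  | step _ _ _ ih => omega

theorem Open.exists_pred (h : Open a U P r x) (hr : a < r) :
    ∃ i y, r = i + 1 ∧ (y = x ∨ y = x + 1) ∧ Open a U P i y := by
  cases h with
  | base => omega
  | step h1 h2 _ => exact ⟨_, _, rfl, h2, h1⟩

theorem Open.trans {V : Set (ZMod w)} (h : Open b V P r x) (hV : ∀ y ∈ V, Open a U P b y) :
    Open a U P r x := by
  induction h with
  | base h1 _ => exact hV _ h1
  | step _ h2 h3 ih => exact .step ih h2 h3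

theorem Open.mono {V : Set (ZMod w)} (h : Open a U P r x) (hUV : U ⊆ V) : Open a V P r x := by
  induction h with
  | base h1 h2 => exact .base (hUV h1) h2
  | step _ h2 h3 ih => exact .step ih h2 h3

theorem Open.split (h : Open a U P r x) (hab : a ≤ b) (hbr : b ≤ r) :
    ∃ y, Open a U P b y ∧ Open b {y} P r x := by
  induction h with
  | @base x h1 h2 =>
    obtain rfl : a = b := by omega
    exact ⟨x, .base h1 h2, .base rfl h2⟩
  | @step r x y h1 h2 h3 ih =>
    rcases Nat.lt_or_ge r b with hb | hb
    · obtain rfl : b = r + 1 := by omega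
      exact ⟨y, .step h1 h2 h3, .base rfl h3⟩
    · obtain ⟨z, hz1, hz2⟩ := ih hb
      exact ⟨z, hz1, .step hz2 h2 h3⟩

/-- A move cannot close an open path unless it places a pebble on its first vertex. -/
theorem Open.flip (h : Open a U P r x) (hPQ : Flip P Q) (hU : ∀ y ∈ U, (a, y) ∉ Q) :
    Open a U Q r x := by
  induction h with
  | base h1 _ => exact .base h1 (hU _ h1)
  | @step r x y h1 h2 h3 ih =>
    refine .step ih h2 fun h4 => ?_
    obtain ⟨v, hv1, hv2⟩ := hPQ
    by_cases hv : (r + 1, y) = v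
    · exact h1.notMem (hv2 _ _ _ hv.symm h2).1
    · exact h3 ((hv1 _ hv).2 h4)

theorem Open.conn (h : Open a U P r x) (hPQ : Conn b c k P Q)
    (hU : ∀ R, Conn b c k P R → ∀ y ∈ U, (a, y) ∉ R) : Open a U Q r x := by
  induction hPQ with
  | refl => exact h
  | tail h1 h2 ih => exact ih.flip h2.1 (hU _ (Relation.ReflTransGen.tail h1 h2))

/-- A vertex with a predecessor that stays empty keeps its state. -/
theorem Flip.mem_iff (h : Flip P Q) (hy : y = x ∨ y = x + 1) (hP : (r, y) ∉ P) :
    (r + 1, x) ∈ P ↔ (r + 1, x) ∈ Q := by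
  obtain ⟨v, hv1, hv2⟩ := h
  by_cases hv : (r + 1, x) = v
  · exact absurd (hv2 _ _ _ hv.symm hy).1 hP
  · exact hv1 _ hv

theorem Conn.mem_iff (h : Conn a b k P Q) (hy : y = x ∨ y = x + 1)
    (hP : ∀ R, Conn a b k P R → (r, y) ∉ R) : (r + 1, x) ∈ P ↔ (r + 1, x) ∈ Q := by
  induction h with
  | refl => rfl
  | tail h1 h2 ih => exact ih.trans (h2.1.mem_iff hy (hP _ h1))

/-! ### Pebble counts of sections. -/

theorem load_add (hab : a ≤ b) (hbc : b ≤ c) : load P a b + load P (b + 1) c = load P a c := by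
  unfold load
  rw [← Finset.card_union_of_disjoint]
  · congr 1
    ext v
    simp only [Finset.mem_union, Finset.mem_filter]
    constructor
    · rintro (⟨h, _, _⟩ | ⟨h, _, _⟩) <;> exact ⟨h, by omega, by omega⟩
    · rintro ⟨h, _, _⟩
      rcases Nat.lt_or_ge b v.1 with hb | hb
      · exact Or.inr ⟨h, by omega, by omega⟩
      · exact Or.inl ⟨h, by omega, by omega⟩
  · rw [Finset.disjoint_left]
    intro v h1 h2
    simp only [Finset.mem_filter] at h1 h2
    omega

theorem load_mono (hab : a ≤ b) (hmr : r ≤ m) : load P b r ≤ load P a m := by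
  refine Finset.card_le_card fun v hv => ?_
  simp only [Finset.mem_filter] at hv ⊢
  exact ⟨hv.1, by omega, by omega⟩

/-- If a move changes the load of a section, it keeps the load of every disjoint section. -/
theorem Flip.load_eq_or {a' b' : ℕ} (h : Flip P Q) (hab : b < a') :
    load P a b = load Q a b ∨ load P a' b' = load Q a' b' := by
  obtain ⟨v, hv, -⟩ := h
  by_cases hvb : v.1 ≤ b
  · right
    unfold load
    congr 1
    ext u
    simp only [Finset.mem_filter]
    refine and_congr_left fun hu => hv u ?_
    rintro rfl
    omega
  · left
    unfold load
    congr 1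
    ext u
    simp only [Finset.mem_filter]
    refine and_congr_left fun hu => hv u ?_
    rintro rfl
    omega

theorem ncard_pebbled_le : {x : ZMod w | (r, x) ∈ P}.ncard ≤ load P r r := by
  have h : (fun x : ZMod w => (r, x)) '' {x | (r, x) ∈ P} ⊆
      ((P.filter fun v => r ≤ v.1 ∧ v.1 ≤ r : Finset (ℕ × ZMod w)) : Set (ℕ × ZMod w)) := by
    rintro _ ⟨x, hx, rfl⟩
    simpa using hx
  have h2 := Set.ncard_le_ncard h (Finset.finite_toSet _)
  rw [Set.ncard_image_of_injective _ (fun x y hxy => by simpa using hxy),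
    Set.ncard_coe_finset] at h2
  exact h2

theorem ncard_univ_zmod : (Set.univ : Set (ZMod w)).ncard = w := by
  rw [Set.ncard_univ, Nat.card_zmod]

variable [NeZero w]

theorem eq_univ_of_add_one {S : Set (ZMod w)} (hS : S.Nonempty) (h : ∀ x, x + 1 ∈ S → x ∈ S) :
    S = Set.univ := by
  obtain ⟨x, hx⟩ := hS
  have key : ∀ (n : ℕ) (y : ZMod w), y + (n : ZMod w) ∈ S → y ∈ S := by
    intro n
    induction n with
    | zero => intro y hy; simpa using hy
    | succ n ih =>
      intro y hy
      refine ih _ (h _ ?_)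
      have : y + ((n + 1 : ℕ) : ZMod w) = y + n + 1 := by push_cast; ring
      rwa [this] at hy
  refine Set.eq_univ_of_forall fun y => key (x - y).val y ?_
  simpa using hx

/-! ### Growth of the open set from layer to layer. -/

theorem ncard_open_succ :
    {x | Open a U P r x}.ncard ≤ {x | Open a U P (r + 1) x}.ncard + load P (r + 1) (r + 1) := by
  have h : {x | Open a U P r x} ⊆ {x | Open a U P (r + 1) x} ∪ {x | (r + 1, x) ∈ P} := by
    intro x hx
    by_cases hP : (r + 1, x) ∈ P
    · exact Or.inr hP
    · exact Or.inl (Open.step hx (Or.inl rfl) hP)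
  calc _ ≤ _ := Set.ncard_le_ncard h (Set.toFinite _)
    _ ≤ _ := Set.ncard_union_le _ _
    _ ≤ _ := by gcongr; exact ncard_pebbled_le

/-- From position `x` a path continues to `x` or `x - 1`. A nonempty proper subset of the cycle is
not closed under `x ↦ x - 1`, so its successors outnumber it by at least one before pebbles are
discounted. -/
theorem ncard_open_succ_of_ne_univ (h0 : {x | Open a U P r x}.Nonempty)
    (h1 : ¬ Open a U P r y) : {x | Open a U P r x}.ncard + 1 ≤
      {x | Open a U P (r + 1) x}.ncard + load P (r + 1) (r + 1) := by
  obtain ⟨z, hz1, hz2⟩ : ∃ z, Open a U P r (z + 1) ∧ ¬ Open a U P r z := by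
    by_contra! hc
    have := eq_univ_of_add_one h0 (fun x hx => hc x hx)
    exact h1 (this.symm ▸ Set.mem_univ y : y ∈ {x | Open a U P r x})
  have h : insert z {x | Open a U P r x} ⊆
      {x | Open a U P (r + 1) x} ∪ {x | (r + 1, x) ∈ P} := by
    intro x hx
    by_cases hP : (r + 1, x) ∈ P
    · exact Or.inr hP
    · rcases hx with rfl | hx
      · exact Or.inl (Open.step hz1 (Or.inr rfl) hP)
      · exact Or.inl (Open.step hx (Or.inl rfl) hP)
  rw [← Set.ncard_insert_of_notMem (show z ∉ {x | Open a U P r x} from hz2) (Set.toFinite _)]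
  calc _ ≤ _ := Set.ncard_le_ncard h (Set.toFinite _)
    _ ≤ _ := Set.ncard_union_le _ _
    _ ≤ _ := by gcongr; exact ncard_pebbled_le

theorem ncard_le_open (d : ℕ) :
    U.ncard ≤ {x | Open a U P (a + d) x}.ncard + load P a (a + d) := by
  induction d with
  | zero =>
    rw [add_zero]
    have h : U ⊆ {x | Open a U P a x} ∪ {x | (a, x) ∈ P} := by
      intro x hx
      by_cases hP : (a, x) ∈ P
      · exact Or.inr hP
      · exact Or.inl (Open.base hx hP)
    calc _ ≤ _ := Set.ncard_le_ncard h (Set.toFinite _)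
      _ ≤ _ := Set.ncard_union_le _ _
      _ ≤ _ := by gcongr; exact ncard_pebbled_le
  | succ d ih =>
    have h1 := ncard_open_succ (a := a) (U := U) (P := P) (r := a + d)
    have h2 := load_add (P := P) (Nat.le_add_right a d) (Nat.le_succ (a + d))
    rw [← add_assoc]
    simp only [Nat.succ_eq_add_one] at h2
    omega

/-- Fewer than `|U|` pebbles cannot separate `U` from a choice of one vertex in each of `w`
consecutive layers. -/
theorem exists_open (f : ℕ → ZMod w) (hac : a ≤ c) (hU : load P a (c + (w - 1)) < U.ncard) :
    ∃ r, c ≤ r ∧ r ≤ c + (w - 1) ∧ Open a U P r (f r) := by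
  by_contra! hc
  have hpos : 0 < w := Nat.pos_of_ne_zero (NeZero.ne w)
  have key : ∀ d, c + d ≤ c + (w - 1) →
      U.ncard + d ≤ {x | Open a U P (c + d) x}.ncard + load P a (c + d) := by
    intro d
    induction d with
    | zero =>
      intro _
      have := ncard_le_open (a := a) (U := U) (P := P) (c - a)
      rw [Nat.add_sub_cancel' hac] at this
      simpa using this
    | succ d ih =>
      intro hd
      have ih := ih (by omega)
      have h2 := load_add (P := P) (show a ≤ c + d by omega) (Nat.le_succ (c + d))
      have h3 : load P a (c + d) ≤ load P a (c + (w - 1)) := load_mono le_rfl (by omega)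
      have h4 : {x | Open a U P (c + d) x}.Nonempty := by
        rw [← Set.ncard_pos (Set.toFinite _)]
        omega
      have h5 := ncard_open_succ_of_ne_univ h4 (hc (c + d) (by omega) (by omega))
      rw [← add_assoc c]
      simp only [Nat.succ_eq_add_one] at h2
      omega
  -- After `w - 1` gains, a load below `U.ncard` leaves at least `w` open vertices, that is, the
  -- whole layer.
  have h1 := key (w - 1) le_rfl
  have h2 : {x | Open a U P (c + (w - 1)) x} = Set.univ := by
    refine Set.eq_of_subset_of_ncard_le (Set.subset_univ _) ?_ (Set.toFinite _)
    rw [Set.ncard_univ, Nat.card_zmod]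
    omega
  exact hc _ (by omega) le_rfl
    (h2.symm ▸ Set.mem_univ (f (c + (w - 1))) : f (c + (w - 1)) ∈ {x | Open a U P (c + (w - 1)) x})

/-- A vertex at the end of an open path with `w` vertices is open from every set that is larger
than the number of pebbles below. -/
theorem Open.reopen {V : Set (ZMod w)} (h : Open c V P (c + (w - 1)) x) (hac : a ≤ c)
    (hU : load P a (c + (w - 1)) < U.ncard) : Open a U P (c + (w - 1)) x := by
  have h1 : ∀ r, ∃ y, c ≤ r → r ≤ c + (w - 1) → Open r {y} P (c + (w - 1)) x := by
    intro r
    by_cases hr : c ≤ r ∧ r ≤ c + (w - 1)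
    · obtain ⟨y, -, hy⟩ := h.split hr.1 hr.2
      exact ⟨y, fun _ _ => hy⟩
    · exact ⟨0, fun h1 h2 => absurd ⟨h1, h2⟩ hr⟩
  choose f hf using h1
  obtain ⟨r, hr1, hr2, hr3⟩ := exists_open f hac hU
  exact (hf r hr1 hr2).trans (by simpa using hr3)

/-! ### Secure sections. -/

/-- Openness of the top vertex is invariant: when a move fills the first vertex of the path, at most
`w - 1` pebbles cannot separate the bottom layer from the rest of the path. -/
theorem secure_base : Secure w (w - 1) (w - 1) := by
  have hpos : 0 < w := Nat.pos_of_ne_zero (NeZero.ne w)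
  intro a P Q x hPQ hP
  suffices h : Open a Set.univ Q (a + (w - 1)) x from h.notMem
  induction hPQ with
  | refl => exact hP
  | @tail Q R _ hQR ih =>
    obtain ⟨hflip, -, hR⟩ := hQR
    by_cases hb : ∃ z, (a, z) ∈ R ∧ (a, z) ∉ Q
    · obtain ⟨z, hz, hz'⟩ := hb
      -- The targets are the old path above layer `a` and, in layer `a`, the newly filled `z`. As
      -- `z` is pebbled, the target that is reached must lie on the surviving path.
      have h1 : ∀ r, ∃ y, a ≤ r → r ≤ a + (w - 1) →
          (r = a ∧ y = z) ∨ Open r {y} R (a + (w - 1)) x := by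
        intro r
        by_cases hr : a < r ∧ r ≤ a + (w - 1)
        · obtain ⟨y, hy1, hy2⟩ := ih.split hr.1.le hr.2
          refine ⟨y, fun _ _ => Or.inr (hy2.flip hflip ?_)⟩
          rintro _ rfl
          obtain ⟨i, p, rfl, hp, hpo⟩ := hy1.exists_pred hr.1
          rw [← hflip.mem_iff hp hpo.notMem]
          exact hy1.notMem
        · exact ⟨z, fun h1 h2 => Or.inl ⟨by omega, rfl⟩⟩
      choose f hf using h1
      obtain ⟨r, hr1, hr2, hr3⟩ := exists_open (a := a) (c := a) (P := R) (U := Set.univ) f le_rfl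
        (by rw [ncard_univ_zmod]; omega)
      rcases hf r hr1 hr2 with ⟨rfl, h⟩ | h
      · rw [h] at hr3
        exact absurd hz hr3.notMem
      · exact h.trans (by simpa using hr3)
    · push Not at hb
      obtain ⟨y, hy1, hy2⟩ := ih.split le_rfl (by omega)
      refine (hy2.flip hflip ?_).mono (Set.subset_univ _)
      rintro _ rfl h
      exact hy1.notMem (hb _ h)

/-- Doubling: in the lower half `A` and the upper half `B` of a long section, one of the two
always has few pebbles. -/
theorem Secure.double {h : ℕ} (hh : 2 * h ≤ w + 1) (hS : Secure w N k) :
    Secure w (2 * N + 1 + w) (k + h) := by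
  have hpos : 0 < w := Nat.pos_of_ne_zero (NeZero.ne w)
  intro a P Q q hPQ hP
  -- `A` is `a, …, a + N` and `B` is `m, …, c + (w - 1)`. The first `N + 1` layers of `B` are again
  -- a secure section; the last `w` layers, from `c` on, are there for rerouting.
  obtain ⟨m, hm⟩ : ∃ m, m = a + N + 1 := ⟨_, rfl⟩
  obtain ⟨c, hc⟩ : ∃ c, c = m + N + 1 := ⟨_, rfl⟩
  have htop : a + (2 * N + 1 + w) = c + (w - 1) := by omega
  rw [htop] at hPQ hP ⊢
  have hsum : ∀ R : Finset (ℕ × ZMod w),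
      load R a (a + N) + load R m (c + (w - 1)) = load R a (c + (w - 1)) := fun R => by
    rw [hm]; exact load_add (by omega) (by omega)
  have hB : ∀ R : Finset (ℕ × ZMod w), load R m (m + N) ≤ load R m (c + (w - 1)) := fun R =>
    load_mono le_rfl (by omega)
  -- The vertices of layer `m` at the positions `U` keep their state while `A` has few pebbles.
  let Guarded (R : Finset (ℕ × ZMod w)) (U : Set (ZMod w)) : Prop := ∀ u ∈ U, ∃ p R',
    (p = u ∨ p = u + 1) ∧ Conn a (a + N) k R R' ∧ Open a Set.univ R' (a + N) p
  have guarded_empty : ∀ {R R' U}, Guarded R U → Conn a (a + N) k R R' → ∀ u ∈ U,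
      ((m, u) ∈ R ↔ (m, u) ∈ R') := by
    intro R R' U hG hRR' u hu
    obtain ⟨p, R'', hp, h1, h2⟩ := hG u hu
    rw [hm]
    exact hRR'.mem_iff hp fun T hT => hS a R'' T p (h1.symm.trans hT) h2
  have guarded_conn : ∀ {R R' U}, Guarded R U → Conn a (a + N) k R R' → Guarded R' U := by
    intro R R' U hG hRR' u hu
    obtain ⟨p, R'', hp, h1, h2⟩ := hG u hu
    exact ⟨p, R'', hp, hRR'.symm.trans h1, h2⟩
  have guarded_open : ∀ {R R' U}, Guarded R U → Conn a (a + N) k R R' →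
      Open m U R (c + (w - 1)) q → Open m U R' (c + (w - 1)) q := by
    intro R R' U hG hRR' hO
    -- restrict to those start vertices that are empty
    have h1 : Open m {u ∈ U | (m, u) ∉ R} R (c + (w - 1)) q := by
      obtain ⟨y, hy1, hy2⟩ := hO.split le_rfl (by omega)
      refine hy2.mono ?_
      rintro _ rfl
      cases hy1 with
      | base h1 h2 => exact ⟨h1, h2⟩
      | step h => exact absurd h.le (by omega)
    refine (h1.conn hRR' fun T hT u hu => ?_).mono fun u hu => hu.1
    rw [← guarded_empty hG hT u hu.1]
    exact hu.2
  -- a light lower half leaves many guarded vertices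
  have guarded_light : ∀ {R}, load R a (a + N) < h →
      ∃ U : Set (ZMod w), Guarded R U ∧ h ≤ U.ncard := by
    intro R hR
    refine ⟨{x | Open a Set.univ R (a + N) x}, fun u hu => ⟨u, R, Or.inl rfl, .refl, hu⟩, ?_⟩
    -- At least `w - (h - 1)` positions are open, which is at least `h` because `2 * h ≤ w + 1`.
    have := ncard_le_open (a := a) (U := Set.univ) (P := R) N
    rw [ncard_univ_zmod] at this
    omega
  -- Three states: `B` is light; `B` is heavy and the path starts at vertices frozen by the security
  -- of `A`; both are heavy, and `g` is kept empty by the security of the lower part of `B`. In the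
  -- third, `R₀` is a reference configuration with light `B`, remembered for the moment when `A`
  -- becomes light.
  let Inv (R : Finset (ℕ × ZMod w)) : Prop :=
    (load R m (c + (w - 1)) < h ∧ Open m Set.univ R (c + (w - 1)) q) ∨
    (h ≤ load R m (c + (w - 1)) ∧ ∃ U, Guarded R U ∧ Open m U R (c + (w - 1)) q) ∨
    (h ≤ load R m (c + (w - 1)) ∧ h ≤ load R a (a + N) ∧ ∃ R₀ g,
      load R₀ m (c + (w - 1)) < h ∧ Open m Set.univ R₀ (c + (w - 1)) q ∧
      Open m Set.univ R₀ (m + N) g ∧ Conn m (m + N) k R₀ R ∧ Conn a (a + N) k R₀ R ∧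
      Open (m + N) {g} R (c + (w - 1)) q)
  have reopen : ∀ {R g}, load R m (c + (w - 1)) < h → Open (m + N) {g} R (c + (w - 1)) q →
      Open m Set.univ R (c + (w - 1)) q := by
    intro R g hR hO
    obtain ⟨y, -, hy⟩ := hO.split (b := c) (by omega) (by omega)
    exact hy.reopen (by omega) (by rw [ncard_univ_zmod]; omega)
  suffices hInv : Inv Q by
    rcases hInv with ⟨-, h⟩ | ⟨-, U, -, h⟩ | ⟨-, -, R₀, g, -, -, -, -, -, h⟩ <;> exact h.notMem
  induction hPQ with
  | refl =>
    rcases Nat.lt_or_ge (load P m (c + (w - 1))) h with hl | hl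
    · obtain ⟨y, -, hy⟩ := hP.split (b := m) (by omega) (by omega)
      exact Or.inl ⟨hl, hy.mono (Set.subset_univ _)⟩
    · obtain ⟨y, hy1, hy2⟩ := hP.split (b := m) (by omega) (by omega)
      refine Or.inr (Or.inl ⟨hl, {y}, ?_, hy2⟩)
      rintro _ rfl
      obtain ⟨i, p, hi, hp, ho⟩ := hy1.exists_pred (by omega)
      obtain rfl : i = a + N := by omega
      exact ⟨p, P, hp, .refl, ho⟩
  | @tail R T _ hRT ih =>
    obtain ⟨hflip, hR, hT⟩ := hRT
    have hsR := hsum R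
    have hsT := hsum T
    have hBR := hB R
    have hBT := hB T
    have hload := hflip.load_eq_or (a := a) (b := a + N) (a' := m) (b' := c + (w - 1)) (by omega)
    -- A heavy `B` leaves at most `k` pebbles for `A`. If `B` is heavy on only one side of the move,
    -- the move happens in `B` and the load of `A` is the same on both sides.
    have connA : h ≤ load R m (c + (w - 1)) ∨ h ≤ load T m (c + (w - 1)) →
        Conn a (a + N) k R T := fun hor =>
      Relation.ReflTransGen.single ⟨hflip, by omega, by omega⟩
    -- the case where the lower half of `T` is light
    have light : ∀ {R₀}, load R₀ m (c + (w - 1)) < h → Open m Set.univ R₀ (c + (w - 1)) q →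
        Conn a (a + N) k R₀ T → load T a (a + N) < h → h ≤ load T m (c + (w - 1)) → Inv T := by
      intro R₀ h1 h2 h3 h4 h5
      -- Guardedness is carried back to `R₀` by reversing the moves. There `B` is light, so `q` is
      -- open from the `h` or more guarded positions, and this path is carried forward to `T`.
      obtain ⟨U, hG, hU⟩ := guarded_light h4
      obtain ⟨y, -, hy⟩ := h2.split (b := c) (by omega) (by omega)
      exact Or.inr (Or.inl ⟨h5, U, hG, guarded_open (guarded_conn hG h3.symm) h3
        (hy.reopen (by omega) (by omega))⟩)
    rcases ih with ⟨hl, ho⟩ | ⟨hl, U, hG, ho⟩ | ⟨hl, hlA, R₀, g, h1, h2, h3, h4, h5, h6⟩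
    · obtain ⟨g, hg1, hg2⟩ := ho.split (b := m + N) (by omega) (by omega)
      -- The path vertex in layer `c` has an empty predecessor on the path, so the move cannot fill
      -- it.
      have hc' : Open c Set.univ T (c + (w - 1)) q := by
        obtain ⟨y, hy1, hy2⟩ := hg2.split (b := c) (by omega) (by omega)
        refine (hy2.flip hflip ?_).mono (Set.subset_univ _)
        rintro _ rfl
        obtain ⟨i, p, rfl, hp, hpo⟩ := hy1.exists_pred (by omega)
        rw [← hflip.mem_iff hp hpo.notMem]
        exact hy1.notMem
      rcases Nat.lt_or_ge (load T m (c + (w - 1))) h with hlT | hlT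
      · exact Or.inl ⟨hlT, hc'.reopen (by omega) (by rw [ncard_univ_zmod]; omega)⟩
      rcases Nat.lt_or_ge (load T a (a + N)) h with hA | hA
      · exact light hl ho (connA (Or.inr hlT)) hA hlT
      have hconnB : Conn m (m + N) k R T :=
        Relation.ReflTransGen.single ⟨hflip, by omega, by omega⟩
      refine Or.inr (Or.inr ⟨hlT, hA, R, g, hl, ho, hg1, hconnB, connA (Or.inr hlT), ?_⟩)
      refine hg2.flip hflip ?_
      rintro _ rfl
      exact hS m R T _ hconnB hg1
    · have hconn := connA (Or.inl hl)
      have ho' := guarded_open hG hconn ho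
      rcases Nat.lt_or_ge (load T m (c + (w - 1))) h with hlT | hlT
      · exact Or.inl ⟨hlT, ho'.mono (Set.subset_univ _)⟩
      · exact Or.inr (Or.inl ⟨hlT, U, guarded_conn hG hconn, ho'⟩)
    · have hconn := h5.trans (connA (Or.inl hl))
      rcases Nat.lt_or_ge (load T a (a + N)) h with hA | hA
      -- `A` drops below `h` in this move, so the load of `B` is unchanged and remains at least `h`.
      · exact light h1 h2 hconn hA (by omega)
      have hconnB : Conn m (m + N) k R₀ T := h4.tail hflip (by omega) (by omega)
      have h6' : Open (m + N) {g} T (c + (w - 1)) q := by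
        refine h6.flip hflip ?_
        rintro _ rfl
        exact hS m R₀ T _ hconnB h3
      rcases Nat.lt_or_ge (load T m (c + (w - 1))) h with hlT | hlT
      · exact Or.inl ⟨hlT, reopen hlT h6'⟩
      · exact Or.inr (Or.inr ⟨hlT, hA, R₀, g, h1, h2, h3, hconnB, hconn, h6'⟩)

/-- The number of layers obeys `L ↦ 2 * L + w` starting from `w`, which gives `(2 ^ (i + 1) - 1) *
w`; each doubling uses the largest admissible `h`, namely `(w + 1) / 2`. -/
theorem secure_iterate (i : ℕ) : Secure w ((2 ^ (i + 1) - 1) * w - 1) (w - 1 + i * ((w + 1) / 2)) := by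
  have hpos : 0 < w := Nat.pos_of_ne_zero (NeZero.ne w)
  induction i with
  | zero => simpa using secure_base
  | succ i ih =>
    have h := ih.double (h := (w + 1) / 2) (by omega)
    convert h using 1
    · obtain ⟨j, hj⟩ : ∃ j, 2 ^ (i + 1) = j + 2 :=
        ⟨2 ^ (i + 1) - 2, by have := Nat.one_le_two_pow (n := i); rw [pow_succ]; omega⟩
      have h2 : 2 ^ (i + 1 + 1) - 1 = 2 * j + 3 := by rw [pow_succ, hj]; omega
      have h3 : 2 ^ (i + 1) - 1 = j + 1 := by omega
      rw [h2, h3]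
      have h4 : (2 * j + 3) * w = 2 * ((j + 1) * w) + w := by ring
      have h5 : 1 ≤ (j + 1) * w := Nat.mul_pos (by omega) hpos
      omega
    · ring

end Cylinder

/-! ### Roads -/

section Road

variable {w ℓ : ℕ}

/-! ### Structure and size of roads. -/

theorem road_isAcyclic (w ℓ : ℕ) : IsAcyclic (road w ℓ) := by
  have key : ∀ u v, Relation.TransGen (road w ℓ).Adj u v → (u.1.1 : ℕ) < v.1.1 := by
    intro u v h
    induction h with
    | single h => have := h.1; omega
    | tail _ h ih => have := h.1; omega
  exact fun v hv => lt_irrefl _ (key v v hv)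

theorem road_fanInAtMost (w ℓ : ℕ) : FanInAtMost (road w ℓ) 2 := by
  intro v
  have h1 : Set.MapsTo (fun u : RoadVertex w ℓ => (u.1.2 : ℕ)) {u | (road w ℓ).Adj u v}
      {(v.1.2 : ℕ), ((v.1.2 : ℕ) + 1) % w} := by
    intro u hu
    simpa using hu.2
  have h2 : Set.InjOn (fun u : RoadVertex w ℓ => (u.1.2 : ℕ)) {u | (road w ℓ).Adj u v} := by
    intro u hu u' hu' h
    have h3 := hu.1
    have h4 := hu'.1
    refine Subtype.ext (Prod.ext (Fin.ext ?_) (Fin.ext h))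
    omega
  exact (Set.encard_le_encard_of_injOn h1 h2).trans ((Set.encard_insert_le _ _).trans
    (by rw [Set.encard_singleton]; norm_num))

theorem road_isSink_iff (hw : 1 ≤ w) {v : RoadVertex w ℓ} :
    IsSink (road w ℓ) v ↔ (v.1.1 : ℕ) = ℓ := by
  obtain ⟨⟨⟨i, hi⟩, ⟨j, hj⟩⟩, hv⟩ := v
  simp only at hv ⊢
  constructor
  · intro h
    by_contra hne
    rcases Nat.lt_or_ge (i + j) ℓ with hl | hl
    · exact h ⟨(⟨i + 1, by omega⟩, ⟨j, hj⟩), by simp only; omega⟩ ⟨rfl, Or.inl rfl⟩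
    · refine h ⟨(⟨i + 1, by omega⟩, ⟨j - 1, by omega⟩), by simp only; omega⟩ ⟨rfl, Or.inr ?_⟩
      simp only
      rw [Nat.sub_add_cancel (by omega), Nat.mod_eq_of_lt hj]
  · rintro rfl u ⟨h, -⟩
    have := u.1.1.2
    simp only at h
    omega

theorem mem_sinks_road (hw : 1 ≤ w) {v : RoadVertex w ℓ} :
    v ∈ sinks (road w ℓ) ↔ (v.1.1 : ℕ) = ℓ := by
  simp [sinks, road_isSink_iff hw]

/-- The vertex at the tip of the pyramid. -/
def roadTip (hw : 1 ≤ w) : RoadVertex w ℓ :=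
  ⟨(⟨ℓ, by omega⟩, ⟨0, by omega⟩), by simp⟩

theorem road_existsUnique_sink (hw : 1 ≤ w) : ∃! z, IsSink (road w ℓ) z := by
  refine ⟨roadTip hw, (road_isSink_iff hw).2 rfl, fun v hv => ?_⟩
  have h1 := (road_isSink_iff hw).1 hv
  have h2 := v.2
  refine Subtype.ext (Prod.ext (Fin.ext h1) (Fin.ext ?_))
  simp only [roadTip]
  omega

theorem card_roadVertex_le (w ℓ : ℕ) : Fintype.card (RoadVertex w ℓ) ≤ (ℓ + 1) * w := by
  refine (Fintype.card_subtype_le _).trans ?_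
  simp

theorem le_card_roadVertex (hwl : w ≤ ℓ + 1) :
    (ℓ + 2 - w) * w ≤ Fintype.card (RoadVertex w ℓ) := by
  rcases Nat.eq_zero_or_pos w with rfl | hw
  · simp
  let f : Fin (ℓ + 2 - w) × Fin w → RoadVertex w ℓ := fun p =>
    ⟨(⟨p.1, by have := p.1.2; omega⟩, p.2), by have := p.1.2; have := p.2.2; simp only; omega⟩
  have hf : Function.Injective f := by
    rintro ⟨⟨i, hi⟩, j⟩ ⟨⟨i', hi'⟩, j'⟩ h
    simpa [f] using h
  simpa using Fintype.card_le_of_injective f hf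

/-! ### Roads inside the cylinder and the reversible lower bound. -/

/-- The position of a vertex of the road on the infinite cylinder. -/
def toCylinder (p : RoadVertex w ℓ) : ℕ × ZMod w := ((p.1.1 : ℕ), ((p.1.2 : ℕ) : ZMod w))

theorem toCylinder_injective : Function.Injective (toCylinder (w := w) (ℓ := ℓ)) := by
  intro p q h
  simp only [toCylinder, Prod.mk.injEq] at h
  refine Subtype.ext (Prod.ext (Fin.ext h.1) (Fin.ext ?_))
  have h2 := (ZMod.natCast_eq_natCast_iff' _ _ _).1 h.2
  rwa [Nat.mod_eq_of_lt p.1.2.2, Nat.mod_eq_of_lt q.1.2.2] at h2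

/-- Cutting off the pyramid removes no predecessor of a remaining vertex, so road moves satisfy the
predecessor condition of `Flip` on the cylinder. -/
theorem exists_adj_toCylinder {v : RoadVertex w ℓ} {i : ℕ} {x y : ZMod w}
    (hv : toCylinder v = (i + 1, x)) (hy : y = x ∨ y = x + 1) :
    ∃ u, (road w ℓ).Adj u v ∧ toCylinder u = (i, y) := by
  obtain ⟨⟨⟨i', hi⟩, ⟨j, hj⟩⟩, hv'⟩ := v
  simp only [toCylinder, Prod.mk.injEq] at hv hv'
  obtain ⟨rfl, rfl⟩ := hv
  rcases hy with rfl | rfl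
  · exact ⟨⟨(⟨i, by omega⟩, ⟨j, hj⟩), by simp only; omega⟩, ⟨rfl, Or.inl rfl⟩, rfl⟩
  -- The wrapped position is at most `j + 1`, so the predecessor one layer down still satisfies the
  -- bound `ℓ`.
  · have h := Nat.mod_le (j + 1) w
    refine ⟨⟨(⟨i, by omega⟩, ⟨(j + 1) % w, Nat.mod_lt _ (by omega)⟩), by simp only; omega⟩,
      ⟨rfl, Or.inr rfl⟩, ?_⟩
    simp [toCylinder]

theorem flip_of_reversibleMove {P Q : Finset (RoadVertex w ℓ)}
    (h : ReversibleMove (road w ℓ) P Q) :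
    Cylinder.Flip (P.map ⟨_, toCylinder_injective⟩) (Q.map ⟨_, toCylinder_injective⟩) := by
  classical
  have key : ∀ (P Q : Finset (RoadVertex w ℓ)) (v : RoadVertex w ℓ),
      (∀ u, (road w ℓ).Adj u v → u ∈ P) → Q = insert v P →
      Cylinder.Flip (P.map ⟨_, toCylinder_injective⟩) (Q.map ⟨_, toCylinder_injective⟩) := by
    rintro P _ v hp rfl
    refine ⟨toCylinder v, fun u hu => ?_, fun i x y hv hy => ?_⟩
    · simp [hu]
    · obtain ⟨u, hu1, hu2⟩ := exists_adj_toCylinder hv hy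
      have h1 : (i, y) ∈ P.map ⟨_, toCylinder_injective⟩ :=
        Finset.mem_map.2 ⟨u, hp u hu1, hu2⟩
      exact ⟨h1, Finset.map_subset_map.2 (Finset.subset_insert _ _) h1⟩
  rcases h with ⟨v, -, hp, hQ⟩ | ⟨u, hu, hp, rfl⟩
  · exact key P Q v hp hQ
  · refine (key _ _ u (fun x hx => Finset.mem_erase.2 ⟨?_, hp x hx⟩)
      (Finset.insert_erase hu).symm).symm
    rintro rfl
    exact road_isAcyclic w ℓ _ (.single hx)

/-- Apply security to the top `N + 1` layers: in the empty configuration the tip is open from below,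
so a pebbling of space at most `k` would never reach it. -/
theorem lt_reversiblePrice_road {N k : ℕ} [NeZero w] (hS : Cylinder.Secure w N k) (hN : N ≤ ℓ) :
    k < reversiblePrice (road w ℓ) := by
  have hw : 1 ≤ w := Nat.one_le_iff_ne_zero.2 (NeZero.ne w)
  have hne : {m | ∃ τ P, IsPebbling (ReversibleMove (road w ℓ)) (sinks (road w ℓ)) τ P ∧
      space τ P = m}.Nonempty := by
    obtain ⟨τ, P, h⟩ := exists_reversible_isPebbling (road_isAcyclic w ℓ) (sinks (road w ℓ))
    exact ⟨_, τ, P, h, rfl⟩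
  obtain ⟨τ, P, ⟨h0, hτ, hmove⟩, hspace⟩ := Nat.sInf_mem hne
  by_contra! hk
  have hcard : ∀ t ≤ τ, (P t).card ≤ k := fun t ht => by
    refine le_trans ?_ (hspace.trans_le hk)
    exact Finset.le_sup (f := fun t => (P t).card) (Finset.mem_range.2 (by omega))
  have hload : ∀ t ≤ τ, Cylinder.load ((P t).map ⟨_, toCylinder_injective⟩) (ℓ - N) (ℓ - N + N) ≤ k :=
    fun t ht => (Finset.card_filter_le _ _).trans (by simpa using hcard t ht)
  have hconn : ∀ t ≤ τ, Cylinder.Conn (ℓ - N) (ℓ - N + N) k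
      ((P 0).map ⟨_, toCylinder_injective⟩) ((P t).map ⟨_, toCylinder_injective⟩) := by
    intro t
    induction t with
    | zero => exact fun _ => .refl
    | succ t ih =>
      exact fun ht => (ih (by omega)).tail (flip_of_reversibleMove (hmove t (by omega)))
        (hload t (by omega)) (hload _ ht)
  have hopen : ∀ d, Cylinder.Open (w := w) (ℓ - N) Set.univ ∅ (ℓ - N + d) 0 := by
    intro d
    induction d with
    | zero => exact .base (Set.mem_univ _) (by simp)
    | succ d ih => exact .step ih (Or.inl rfl) (by simp)
  refine hS (ℓ - N) _ _ 0 (hconn τ le_rfl) (by simpa [h0] using hopen N) ?_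
  refine Finset.mem_map.2 ⟨roadTip hw, ?_, ?_⟩
  · rw [hτ, mem_sinks_road hw]
    rfl
  · simp [toCylinder, roadTip, Nat.sub_add_cancel hN]

theorem le_reversiblePrice_road (hw : 1 ≤ w) (hwl : w ≤ ℓ + 1) :
    (w : ℝ) * Real.logb 2 ((ℓ : ℝ) / (w : ℝ)) / 2 ≤ (reversiblePrice (road w ℓ) : ℝ) := by
  have : NeZero w := ⟨by omega⟩
  -- The largest number of doublings whose section still fits into the `ℓ + 1` layers.
  obtain ⟨i, hi1, hi2⟩ : ∃ i, (2 ^ (i + 1) - 1) * w ≤ ℓ + 1 ∧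
      ℓ + 1 < (2 ^ (i + 2) - 1) * w := by
    have hex : ∃ i, ℓ + 1 < (2 ^ (i + 2) - 1) * w := by
      refine ⟨ℓ, ?_⟩
      have h1 : ℓ + 2 < 2 ^ (ℓ + 2) := Nat.lt_two_pow_self
      calc ℓ + 1 < 2 ^ (ℓ + 2) - 1 := by omega
        _ ≤ _ := Nat.le_mul_of_pos_right _ hw
    classical
    refine ⟨Nat.find hex, ?_, Nat.find_spec hex⟩
    rcases hf : Nat.find hex with _ | i
    · simpa using hwl
    · have := Nat.find_min hex (m := i) (by omega)
      exact not_lt.1 this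
  have hlt := lt_reversiblePrice_road (w := w) (ℓ := ℓ) (Cylinder.secure_iterate i) (by omega)
  -- The price is at least `w + i * ((w + 1) / 2)`. The base term `w` supplies exactly the `+ 2` in
  -- the bound on the logarithm.
  have h1 : w * (i + 2) ≤ 2 * reversiblePrice (road w ℓ) := by
    have h2 : i * w ≤ 2 * (i * ((w + 1) / 2)) := by
      calc i * w ≤ i * (2 * ((w + 1) / 2)) := Nat.mul_le_mul_left _ (by omega)
        _ = _ := by ring
    have h3 : w * (i + 2) = i * w + 2 * w := by ring
    omega
  have hw' : (0 : ℝ) < w := by exact_mod_cast hw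
  have hlog : Real.logb 2 ((ℓ : ℝ) / (w : ℝ)) ≤ (i : ℝ) + 2 := by
    -- For `ℓ = 0` the logarithm takes its default value `0`.
    rcases Nat.eq_zero_or_pos ℓ with rfl | hl
    · simp only [Nat.cast_zero, zero_div, Real.logb_zero]
      positivity
    have hl' : (0 : ℝ) < ℓ := by exact_mod_cast hl
    rw [Real.logb_le_iff_le_rpow (by norm_num) (by positivity), div_le_iff₀ hw']
    have h4 : ℓ ≤ 2 ^ (i + 2) * w := by
      have : (2 ^ (i + 2) - 1) * w ≤ 2 ^ (i + 2) * w := Nat.mul_le_mul_right _ (Nat.sub_le _ _)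
      omega
    have h5 : (ℓ : ℝ) ≤ 2 ^ (i + 2) * w := by exact_mod_cast h4
    have h6 : (2 : ℝ) ^ ((i : ℝ) + 2) = 2 ^ (i + 2) := by
      rw [← Real.rpow_natCast]; push_cast; rfl
    rwa [h6]
  have h7 : (w : ℝ) * (i + 2) ≤ 2 * (reversiblePrice (road w ℓ) : ℝ) := by exact_mod_cast h1
  have h8 := mul_le_mul_of_nonneg_left hlog hw'.le
  linarith

end Road

/-! ### Standard pebblings of bounded space -/

theorem configPrice_le_of_reflTransGen {V : Type*} {move : Finset V → Finset V → Prop}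
    {C : Finset V} {K : ℕ}
    (h : Relation.ReflTransGen (fun P Q => move P Q ∧ P.card ≤ K ∧ Q.card ≤ K) ∅ C) :
    configPrice move C ≤ K := by
  obtain ⟨τ, P, h0, hτ, hmove⟩ := exists_isPebbling_of_reflTransGen h
  have hP : IsPebbling move C τ P := ⟨h0, hτ, fun t ht => (hmove t ht).1⟩
  refine le_trans (Nat.sInf_le ⟨τ, P, hP, rfl⟩) ?_
  refine Finset.sup_le fun t ht => ?_
  rcases t with _ | t
  · simp [h0]
  · exact (hmove t (by simpa using ht)).2.2

section Standard

variable {V : Type*} [DecidableEq V] {G : Digraph V} {K : ℕ}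

theorem standard_reach_union {S : Finset V} (T : Finset V) (hT : ∀ v ∈ T, ∀ u, G.Adj u v → u ∈ S)
    (hK : (S ∪ T).card ≤ K) :
    Relation.ReflTransGen (fun P Q => StandardMove G P Q ∧ P.card ≤ K ∧ Q.card ≤ K) S (S ∪ T) := by
  induction T using Finset.induction_on with
  | empty => simpa using Relation.ReflTransGen.refl
  | @insert v T hv ih =>
    rw [Finset.union_insert] at hK ⊢
    have h1 : (S ∪ T).card ≤ K := (Finset.card_le_card (Finset.subset_insert _ _)).trans hK
    have h2 := ih (fun x hx => hT x (Finset.mem_insert_of_mem hx)) h1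
    by_cases hvS : v ∈ S ∪ T
    · rwa [Finset.insert_eq_of_mem hvS]
    · refine h2.tail ⟨Or.inl ⟨v, hvS, fun u hu => ?_, rfl⟩, h1, hK⟩
      exact Finset.mem_union_left _ (hT v (Finset.mem_insert_self _ _) u hu)

theorem standard_reach_sdiff {S : Finset V} (T : Finset V) (hK : S.card ≤ K) :
    Relation.ReflTransGen (fun P Q => StandardMove G P Q ∧ P.card ≤ K ∧ Q.card ≤ K) S (S \ T) := by
  induction T using Finset.induction_on with
  | empty => simpa using Relation.ReflTransGen.refl
  | @insert v T hv ih =>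
    have h : S \ insert v T = (S \ T).erase v := by
      ext x; simp only [Finset.mem_sdiff, Finset.mem_insert, Finset.mem_erase]; tauto
    rw [h]
    by_cases hvS : v ∈ S \ T
    · exact ih.tail ⟨Or.inr ⟨v, hvS, rfl⟩, (Finset.card_le_card Finset.sdiff_subset).trans hK,
        (Finset.card_le_card ((Finset.erase_subset _ _).trans Finset.sdiff_subset)).trans hK⟩
    · rwa [Finset.erase_eq_of_notMem hvS]

end Standard

section Road

variable {w ℓ : ℕ}

/-! ### Standard pebbling of roads and the choice of width. -/

/-- The layer `i` of a road. -/
def roadLayer (w ℓ i : ℕ) : Finset (RoadVertex w ℓ) :=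
  Finset.univ.filter fun v => (v.1.1 : ℕ) = i

theorem mem_roadLayer {i : ℕ} {v : RoadVertex w ℓ} : v ∈ roadLayer w ℓ i ↔ (v.1.1 : ℕ) = i := by
  simp [roadLayer]

theorem card_roadLayer_le (w ℓ i : ℕ) : (roadLayer w ℓ i).card ≤ w := by
  have h := Finset.card_le_card_of_injOn (s := roadLayer w ℓ i) (t := Finset.univ)
    (fun v => v.1.2) (fun _ _ => Finset.mem_univ _) (fun u hu v hv h => by
      have h1 := mem_roadLayer.1 hu
      have h2 := mem_roadLayer.1 hv
      exact Subtype.ext (Prod.ext (Fin.ext (h1.trans h2.symm)) h))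
  simpa using h

/-- Fill the next layer, then clear the current one: only two adjacent layers are ever occupied. -/
theorem standardPrice_road_le (hw : 1 ≤ w) : standardPrice (road w ℓ) ≤ 2 * w := by
  have hs : sinks (road w ℓ) = roadLayer w ℓ ℓ := by
    ext v
    rw [mem_sinks_road hw, mem_roadLayer]
  unfold standardPrice
  rw [hs]
  refine configPrice_le_of_reflTransGen ?_
  have key : ∀ i, Relation.ReflTransGen (fun P Q => StandardMove (road w ℓ) P Q ∧
      P.card ≤ 2 * w ∧ Q.card ≤ 2 * w) ∅ (roadLayer w ℓ i) := by
    intro i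
    induction i with
    | zero =>
      have h := standard_reach_union (G := road w ℓ) (K := 2 * w) (S := ∅) (roadLayer w ℓ 0)
        (fun v hv u hu => by
          have h1 := mem_roadLayer.1 hv
          have h2 := hu.1
          omega)
        (by have := card_roadLayer_le w ℓ 0; rw [Finset.empty_union]; omega)
      simpa using h
    | succ i ih =>
      have hcard : (roadLayer w ℓ i ∪ roadLayer w ℓ (i + 1)).card ≤ 2 * w := by
        have h1 := card_roadLayer_le w ℓ i
        have h2 := card_roadLayer_le w ℓ (i + 1)
        have h3 := Finset.card_union_le (roadLayer w ℓ i) (roadLayer w ℓ (i + 1))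
        omega
      have h1 := standard_reach_union (G := road w ℓ) (S := roadLayer w ℓ i)
        (roadLayer w ℓ (i + 1)) (fun v hv u hu => by
          have h1 := mem_roadLayer.1 hv
          have h2 := hu.1
          exact mem_roadLayer.2 (by omega)) hcard
      have h2 := standard_reach_sdiff (G := road w ℓ) (roadLayer w ℓ i) hcard
      have h3 : (roadLayer w ℓ i ∪ roadLayer w ℓ (i + 1)) \ roadLayer w ℓ i =
          roadLayer w ℓ (i + 1) := by
        ext v
        simp only [Finset.mem_sdiff, Finset.mem_union, mem_roadLayer]
        omega
      rw [h3] at h2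
      exact (ih.trans h1).trans h2
  exact key ℓ

/-- The road with about `n` vertices and width `w` has a large reversible price. -/
theorem le_reversiblePrice_road_of_sq_le {n : ℕ} {ε K σ : ℝ} (hε : 0 < ε) (hn : 1 ≤ n)
    (hσ : σ ≤ w) (hw : 1 ≤ w) (hw2 : (w : ℝ) ≤ K * (n : ℝ) ^ (1 / 2 - ε))
    (hnK : K ^ 2 ≤ (n : ℝ) ^ ε) :
    1 / 2 * ε * (σ * Real.logb 2 n) ≤ (reversiblePrice (road w (n / w + w)) : ℝ) := by
  have hn' : (1 : ℝ) ≤ n := by exact_mod_cast hn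
  have hn0 : (0 : ℝ) < n := by linarith
  have hw' : (1 : ℝ) ≤ w := by exact_mod_cast hw
  have hlog0 : 0 ≤ Real.logb 2 (n : ℝ) := Real.logb_nonneg (by norm_num) hn'
  have h1 : (n : ℝ) / w ≤ ((n / w + w : ℕ) : ℝ) := by
    rw [div_le_iff₀ (by linarith)]
    have h := Nat.div_add_mod n w
    have h' := Nat.mod_lt n (show 0 < w by omega)
    have : n ≤ (n / w + w) * w := by nlinarith
    exact_mod_cast this
  have h2 : (w : ℝ) ^ 2 * (n : ℝ) ^ ε ≤ n := by
    have h3 : (w : ℝ) ^ 2 ≤ K ^ 2 * (n : ℝ) ^ (1 - 2 * ε) := by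
      calc (w : ℝ) ^ 2 ≤ (K * (n : ℝ) ^ (1 / 2 - ε)) ^ 2 := by gcongr
        _ = K ^ 2 * (n : ℝ) ^ (1 - 2 * ε) := by
          rw [mul_pow, ← Real.rpow_natCast ((n : ℝ) ^ (1 / 2 - ε)), ← Real.rpow_mul hn0.le]
          congr 2
          push_cast
          ring
    calc (w : ℝ) ^ 2 * (n : ℝ) ^ ε ≤ (n : ℝ) ^ ε * (n : ℝ) ^ (1 - 2 * ε) * (n : ℝ) ^ ε := by
          gcongr
          exact h3.trans (by gcongr)
      _ = n := by
          rw [← Real.rpow_add hn0, ← Real.rpow_add hn0]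
          ring_nf
          exact Real.rpow_one _
  -- Here `ℓ / w ≥ n / w ^ 2 ≥ n ^ ε`, which makes the logarithm at least `ε * logb 2 n`.
  have h4 : (n : ℝ) ^ ε ≤ ((n / w + w : ℕ) : ℝ) / w := by
    rw [le_div_iff₀ (by linarith)]
    refine le_trans ?_ h1
    rw [le_div_iff₀ (by linarith)]
    calc (n : ℝ) ^ ε * w * w = (w : ℝ) ^ 2 * (n : ℝ) ^ ε := by ring
      _ ≤ n := h2
  have h5 : ε * Real.logb 2 n ≤ Real.logb 2 (((n / w + w : ℕ) : ℝ) / w) := by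
    rw [← Real.logb_rpow_eq_mul_logb_of_pos hn0]
    exact Real.logb_le_logb_of_le (by norm_num) (by positivity) h4
  have h6 := le_reversiblePrice_road (w := w) (ℓ := n / w + w) hw
    ((Nat.le_add_left _ _).trans (Nat.le_succ _))
  have h7 : σ * (ε * Real.logb 2 n) ≤ w * Real.logb 2 (((n / w + w : ℕ) : ℝ) / w) :=
    mul_le_mul hσ h5 (by positivity) (by linarith)
  linarith

end Road

end Pebbling

theorem theorem1 :
    -- the core bound: the reversible price of a road
    (∀ w ℓ : ℕ, 1 ≤ w → w ≤ ℓ + 1 →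
      (w : ℝ) * Real.logb 2 ((ℓ : ℝ) / (w : ℝ)) / 2 ≤
        (Pebbling.reversiblePrice (Pebbling.road w ℓ) : ℝ)) ∧
    -- the separation; the constants `a`, `b`, `C`, `c` are absolute
    ∃ a b C c : ℝ, 0 < a ∧ 0 < b ∧ 0 < C ∧ 0 < c ∧
      ∀ (ε : ℝ) (s : ℕ → ℝ), 0 < ε → (∀ᶠ n : ℕ in atTop, 1 ≤ s n) →
        s =O[atTop] (fun n : ℕ => (n : ℝ) ^ (1 / 2 - ε)) →
        ∃ w ℓ : ℕ → ℕ,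
          (∀ n : ℕ, 1 ≤ n →
            1 ≤ w n ∧ w n ≤ ℓ n + 1 ∧
            Pebbling.IsAcyclic (Pebbling.road (w n) (ℓ n)) ∧
            (∃! z, Pebbling.IsSink (Pebbling.road (w n) (ℓ n)) z) ∧
            Pebbling.FanInAtMost (Pebbling.road (w n) (ℓ n)) 2) ∧
          (∀ n : ℕ, 1 ≤ n →
            a * (n : ℝ) ≤ (Fintype.card (Pebbling.RoadVertex (w n) (ℓ n)) : ℝ) ∧
            (Fintype.card (Pebbling.RoadVertex (w n) (ℓ n)) : ℝ) ≤ b * (n : ℝ)) ∧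
          (∀ᶠ n : ℕ in atTop,
            (Pebbling.standardPrice (Pebbling.road (w n) (ℓ n)) : ℝ) ≤ C * s n) ∧
          (∀ᶠ n : ℕ in atTop,
            c * ε * (s n * Real.logb 2 (n : ℝ)) ≤
              (Pebbling.reversiblePrice (Pebbling.road (w n) (ℓ n)) : ℝ)) := by
  refine ⟨fun w ℓ hw hwl => Pebbling.le_reversiblePrice_road hw hwl, 1, 3, 4, 1 / 2,
    by norm_num, by norm_num, by norm_num, by norm_num, fun ε s hε hs hO => ?_⟩
  obtain ⟨K, hK, hsK⟩ := hO.exists_pos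
  -- The cap `Nat.sqrt n` ensures `w ^ 2 ≤ n`, so the vertex count is linear for every `n ≥ 1`; for
  -- large `n` it is inactive and `w n = ⌈s n⌉₊`.
  let w : ℕ → ℕ := fun n => max 1 (min ⌈s n⌉₊ (Nat.sqrt n))
  have hw1 : ∀ n, 1 ≤ w n := fun n => le_max_left _ _
  have hw2 : ∀ n, 1 ≤ n → w n * w n ≤ n := fun n hn =>
    Nat.le_sqrt.1 (max_le (Nat.le_sqrt.2 (by simpa using hn)) (min_le_right _ _))
  -- The summand `w n` in the length guarantees `w ≤ ℓ + 1` and leaves more than `n / w n` full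
  -- layers below the pyramid.
  refine ⟨w, fun n => n / w n + w n, fun n _ => ⟨hw1 n,
    (Nat.le_add_left _ _).trans (Nat.le_succ _), Pebbling.road_isAcyclic _ _,
    Pebbling.road_existsUnique_sink (hw1 n), Pebbling.road_fanInAtMost _ _⟩, fun n hn => ?_, ?_, ?_⟩
  · have hdm := Nat.div_add_mod (n) (w n)
    have hm := Nat.mod_lt n (show 0 < w n from hw1 n)
    have h1 := Pebbling.le_card_roadVertex (w := w n) (ℓ := n / w n + w n)
      ((Nat.le_add_left _ _).trans (Nat.le_succ _))
    have h2 := Pebbling.card_roadVertex_le (w n) (n / w n + w n)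
    have h3 := hw2 n hn
    have h4 := hw1 n
    rw [add_right_comm, Nat.add_sub_cancel] at h1
    have h7 : w n ≤ w n * w n := Nat.le_mul_of_pos_left _ (hw1 n)
    have h5 : n ≤ Fintype.card (Pebbling.RoadVertex (w n) (n / w n + w n)) := by nlinarith
    have h6 : Fintype.card (Pebbling.RoadVertex (w n) (n / w n + w n)) ≤ 3 * n := by
      have h8 : (n / w n + w n + 1) * w n = w n * (n / w n) + w n * w n + w n := by ring
      linarith [Nat.zero_le (n % w n)]
    constructor
    · rw [one_mul]; exact_mod_cast h5
    · exact_mod_cast h6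
  · filter_upwards [hs] with n hn
    have h1 : (w n : ℝ) ≤ 2 * s n := by
      have h2 : w n ≤ ⌈s n⌉₊ := max_le (Nat.one_le_ceil_iff.2 (by linarith)) (min_le_left _ _)
      have h3 := Nat.ceil_lt_add_one (show 0 ≤ s n by linarith)
      have h4 : (w n : ℝ) ≤ (⌈s n⌉₊ : ℝ) := by exact_mod_cast h2
      linarith
    have h5 : (Pebbling.standardPrice (Pebbling.road (w n) (n / w n + w n)) : ℝ) ≤ 2 * w n := by
      exact_mod_cast Pebbling.standardPrice_road_le (hw1 n)
    linarith
  · have hlarge : ∀ᶠ n : ℕ in atTop, (2 * K) ^ 2 ≤ (n : ℝ) ^ ε :=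
      ((tendsto_rpow_atTop hε).comp tendsto_natCast_atTop_atTop).eventually_ge_atTop _
    filter_upwards [hs, hsK.bound, hlarge, eventually_ge_atTop 1] with n hn hnK hnl hn1
    have hn' : (1 : ℝ) ≤ n := by exact_mod_cast hn1
    have h1 : s n ≤ K * (n : ℝ) ^ (1 / 2 - ε) := by
      rw [Real.norm_of_nonneg (by linarith), Real.norm_of_nonneg (by positivity)] at hnK
      exact hnK
    have h2 : (⌈s n⌉₊ : ℝ) ≤ 2 * K * (n : ℝ) ^ (1 / 2 - ε) := by
      have h3 := Nat.ceil_lt_add_one (show 0 ≤ s n by linarith)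
      linarith
    have h3 : ⌈s n⌉₊ ≤ Nat.sqrt n := by
      rw [Nat.le_sqrt]
      have h4 : (⌈s n⌉₊ : ℝ) ^ 2 ≤ n := by
        calc (⌈s n⌉₊ : ℝ) ^ 2 ≤ (2 * K * (n : ℝ) ^ (1 / 2 - ε)) ^ 2 := by gcongr
          _ = (2 * K) ^ 2 * (n : ℝ) ^ (1 - 2 * ε) := by
            rw [mul_pow, ← Real.rpow_natCast ((n : ℝ) ^ (1 / 2 - ε)),
              ← Real.rpow_mul (by linarith)]
            congr 2
            push_cast
            ring
          _ ≤ (n : ℝ) ^ ε * (n : ℝ) ^ (1 - 2 * ε) := by gcongr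
          _ = (n : ℝ) ^ (1 - ε) := by
            rw [← Real.rpow_add (by linarith)]
            ring_nf
          _ ≤ (n : ℝ) ^ (1 : ℝ) := Real.rpow_le_rpow_of_exponent_le hn' (by linarith)
          _ = n := Real.rpow_one _
      rw [sq] at h4
      exact_mod_cast h4
    have h4 : w n = ⌈s n⌉₊ := by
      simp only [w]
      rw [min_eq_left h3, max_eq_right (Nat.one_le_ceil_iff.2 (by linarith))]
    refine Pebbling.le_reversiblePrice_road_of_sq_le hε hn1 (K := 2 * K) ?_ (hw1 n)
      (by rw [h4]; exact h2) hnl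
    rw [h4]
    exact Nat.le_ceil _
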